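/- All Hilbert spaces are finite-dimensional and complex, $\log$ is the logarithm to base $2$, and $\langle X,Y\rangle=\operatorname{Tr}(X^\dagger Y)$. For a state $\rho$ (positive semidefinite, $\operatorname{Tr}\rho=1$), a positive semidefinite operator $\sigma$ on the same space, and $\epsilon>0$, the hypothesis-testing relative entropy $D_H^{\epsilon}(\rho\Vert\sigma)\in[-\infty,\infty]$ is defined by $$2^{-D_H^{\epsilon}(\rho\Vert\sigma)}=\frac1\epsilon\,\min\bigl\{\langle Q,\sigma\rangle \;:\; 0\le Q\le \mathbb I,\ \langle Q,\rho\rangle\ge\epsilon\bigr\},$$ where the minimum over the empty set is $+\infty$ (this happens exactly when $\epsilon>1$). For a bipartite state $\rho_{AB}$ with marginal $\rho_B=\operatorname{Tr}_A\rho_{AB}$, put $$H_H^{\epsilon}(A|B)_\rho=-D_H^{\epsilon}(\rho_{AB}\Vert\mathbb I_A\otimes\rho_B).$$ **Corollary (chain rule for $H_H^\epsilon$).** Let $\rho_{ABC}$ be an arbitrary normalized state on $\mathcal H_A\otimes\mathcal H_B\otimes\mathcal H_C$, and let $\epsilon,\epsilon'>0$. Then $$H_H^{\epsilon+\sqrt{8\epsilon'}}(AB|C)_\rho\;\ge\;H_H^{\epsilon}(A|BC)_\rho+H_H^{\epsilon'}(B|C)_\rho-\log\frac{\epsilon+\sqrt{2\epsilon'}}{\epsilon},$$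 where $H_H^{\epsilon'}(B|C)_\rho$ is evaluated on the marginal $\rho_{BC}=\operatorname{Tr}_A\rho_{ABC}$. -/

import Mathlib

namespace HypothesisEntropy

open scoped Kronecker ENNReal ComplexOrder

/-- A normalized quantum state on the finite-dimensional Hilbert space `ℂ^n`. -/
def IsState {n : Type*} [Fintype n] (ρ : Matrix n n ℂ) : Prop :=
  ρ.PosSemidef ∧ ρ.trace = 1

/-- The Hilbert-Schmidt inner product `⟨X, Y⟩ = Tr (X† Y)`. -/
noncomputable def hsInner {n : Type*} [Fintype n] (X Y : Matrix n n ℂ) : ℂ :=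
  (X.conjTranspose * Y).trace

/-- The partial trace over the first tensor factor: `ρ_AB ↦ ρ_B = Tr_A ρ_AB`. -/
noncomputable def partialTraceLeft {a b : Type*} [Fintype a]
    (ρ : Matrix (a × b) (a × b) ℂ) : Matrix b b ℂ :=
  Matrix.of fun j k => ∑ i, ρ (i, j) (i, k)

/-- The tests for `ρ` with success probability at least `ε`: operators `Q` with
`0 ≤ Q ≤ 1` and `⟨Q, ρ⟩ ≥ ε`. (The inner product is a real number when `Q` and `ρ` are
Hermitian.) -/
def tests {n : Type*} [Fintype n] [DecidableEq n] (ε : ℝ) (ρ : Matrix n n ℂ) :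
    Set (Matrix n n ℂ) :=
  {Q | Q.PosSemidef ∧ (1 - Q).PosSemidef ∧ ε ≤ (hsInner Q ρ).re}

/-- The optimal value `(1/ε) min {⟨Q, σ⟩ | 0 ≤ Q ≤ 1, ⟨Q, ρ⟩ ≥ ε}`, for positive semidefinite `σ`.
It is `∞` exactly when there is no admissible `Q`. -/
noncomputable def optValue {n : Type*} [Fintype n] [DecidableEq n] (ε : ℝ)
    (ρ σ : Matrix n n ℂ) : ℝ≥0∞ :=
  ⨅ Q ∈ tests ε ρ, ENNReal.ofReal ((1 / ε) * (hsInner Q σ).re)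

/-- The binary logarithm on `[0, ∞]`, with `log 0 = -∞` and `log ∞ = ∞`. -/
noncomputable def log2 (x : ℝ≥0∞) : EReal :=
  ENNReal.log x / ((Real.log 2 : ℝ) : EReal)

/-- The hypothesis testing relative entropy, given by
`2 ^ (-D_H^ε(ρ‖σ)) = (1/ε) min {⟨Q, σ⟩ | 0 ≤ Q ≤ 1, ⟨Q, ρ⟩ ≥ ε}`. -/
noncomputable def relEntropyH {n : Type*} [Fintype n] [DecidableEq n] (ε : ℝ)
    (ρ σ : Matrix n n ℂ) : EReal :=
  -log2 (optValue ε ρ σ)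

/-- The conditional entropy `H_H^ε(A|B)_ρ = -D_H^ε(ρ_AB ‖ 1_A ⊗ ρ_B)` of a bipartite state
on `ℂ^a ⊗ ℂ^b`. -/
noncomputable def condEntropyH {a b : Type*} [Fintype a] [DecidableEq a] [Fintype b]
    [DecidableEq b] (ε : ℝ) (ρ : Matrix (a × b) (a × b) ℂ) : EReal :=
  -relEntropyH ε ρ ((1 : Matrix a a ℂ) ⊗ₖ partialTraceLeft ρ)

/-- The tripartite operator on `A ⊗ (B ⊗ C)` regarded as a bipartite operator on
`(A ⊗ B) ⊗ C`. -/
def regroup {a b c : Type*} (ρ : Matrix (a × b × c) (a × b × c) ℂ) :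
    Matrix ((a × b) × c) ((a × b) × c) ℂ :=
  ρ.submatrix (Equiv.prodAssoc a b c) (Equiv.prodAssoc a b c)

end HypothesisEntropy

namespace HypothesisEntropy

open Matrix
open scoped Kronecker ENNReal ComplexOrder

/-! ### Positivity of traces of products. -/

section Trace

variable {n : Type*} [Fintype n]

/-! Put `c = √(2ε')`, `v = 2 ^ H(A|BC)`, `w = 2 ^ H(B|C)`, `σ = 1 ⊗ ρ_C`. Since tests of `ρ_BC` at
level `ε'` cost at least `w ε'`, the positive part of `w ρ_BC - σ` has trace at most `w ε'`. Hence
(`exists_smoothing`) a contraction `T` on `BC` satisfies `w T ρ_BC T† ≤ σ` while `Re Tr (T ρ_BC)` is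
nearly `1 - ε'`.

A test `Q` of `ρ_ABC` at level `ε + 2c` is pulled back to `Q' = (1 ⊗ T)† Q (1 ⊗ T)`. By
`re_trace_test_contraction` this loses little more than `c` in success probability, so `Q'` has
level `e = ε + c - c²`, and `v e ≤ ⟨Q', 1 ⊗ ρ_BC⟩ = ⟨Q, 1 ⊗ T ρ_BC T†⟩ ≤ ⟨Q, 1 ⊗ σ⟩ / w` for `w >
0`. Minimizing over `Q` and taking logarithms gives the chain rule. -/

open scoped MatrixOrder Matrix.Norms.L2Operator in
lemma re_trace_mul_nonneg {A B : Matrix n n ℂ} (hA : A.PosSemidef) (hB : B.PosSemidef) :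
    0 ≤ (A * B).trace.re := by
  classical
  obtain ⟨C, hC⟩ := CStarAlgebra.nonneg_iff_eq_star_mul_self.mp hB.nonneg
  have h := (hA.mul_mul_conjTranspose_same C).trace_nonneg
  rw [trace_mul_comm, ← Matrix.mul_assoc, trace_mul_comm, ← star_eq_conjTranspose, ← hC] at h
  exact (Complex.le_def.mp h).1

lemma re_trace_mul_mono {A B C : Matrix n n ℂ} (hA : A.PosSemidef) (hBC : (C - B).PosSemidef) :
    (A * B).trace.re ≤ (A * C).trace.re := by
  have h := re_trace_mul_nonneg hA hBC
  rw [Matrix.mul_sub, trace_sub, Complex.sub_re] at h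
  linarith

lemma re_trace_conjTranspose (A : Matrix n n ℂ) : Aᴴ.trace.re = A.trace.re := by
  simp [trace_conjTranspose]

lemma re_trace_conjTranspose_mul (T : Matrix n n ℂ) {ρ : Matrix n n ℂ} (hρ : ρ.IsHermitian) :
    (Tᴴ * ρ).trace.re = (T * ρ).trace.re := by
  rw [← re_trace_conjTranspose (T * ρ), conjTranspose_mul, hρ.eq, trace_mul_comm]

lemma hsInner_eq_of_isHermitian {Q : Matrix n n ℂ} (hQ : Q.IsHermitian) (σ : Matrix n n ℂ) :
    hsInner Q σ = (Q * σ).trace := by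
  rw [hsInner, hQ.eq]

end Trace

/-! ### Smoothing by contractions and its effect on tests. -/

section Operators

variable {n : Type*} [Fintype n] [DecidableEq n]

/-- The positive part `X = P H` of a Hermitian matrix, with `P` its spectral projection. -/
lemma exists_positivePart {H : Matrix n n ℂ} (hH : H.IsHermitian) :
    ∃ P : Matrix n n ℂ, P.PosSemidef ∧ (1 - P).PosSemidef ∧ (P * H).PosSemidef ∧
      (P * H - H).PosSemidef := by
  set U : Matrix n n ℂ := (hH.eigenvectorUnitary : Matrix n n ℂ) with hU
  have hUU : Uᴴ * U = 1 := by
    have := (Unitary.mem_iff.mp hH.eigenvectorUnitary.2).1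
    simpa [star_eq_conjTranspose] using this
  have hUU' : U * Uᴴ = 1 := by
    have := (Unitary.mem_iff.mp hH.eigenvectorUnitary.2).2
    simpa [star_eq_conjTranspose] using this
  have hHU : H = U * diagonal (fun i => (hH.eigenvalues i : ℂ)) * Uᴴ := by
    have := hH.spectral_theorem
    rw [Unitary.conjStarAlgAut_apply] at this
    exact this
  have hdiag : ∀ f : n → ℂ, (∀ i, 0 ≤ f i) → (U * diagonal f * Uᴴ).PosSemidef := fun f hf =>
    (PosSemidef.diagonal hf).mul_mul_conjTranspose_same U
  have hmul : ∀ f g : n → ℂ, (U * diagonal f * Uᴴ) * (U * diagonal g * Uᴴ) =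
      U * diagonal (fun i => f i * g i) * Uᴴ := fun f g => by
    calc _ = U * diagonal f * (Uᴴ * U) * diagonal g * Uᴴ := by simp only [Matrix.mul_assoc]
      _ = _ := by rw [hUU, Matrix.mul_one, Matrix.mul_assoc U, diagonal_mul_diagonal]
  have hsub : ∀ f g : n → ℂ, U * diagonal f * Uᴴ - U * diagonal g * Uᴴ =
      U * diagonal (fun i => f i - g i) * Uᴴ := fun f g => by
    rw [← Matrix.sub_mul, ← Matrix.mul_sub, diagonal_sub]
  have hone : (1 : Matrix n n ℂ) = U * diagonal (fun _ => 1) * Uᴴ := by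
    rw [diagonal_one, Matrix.mul_one, hUU']
  have hPH : ∀ P : Matrix n n ℂ, P * H =
      P * (U * diagonal (fun i => (hH.eigenvalues i : ℂ)) * Uᴴ) := fun P => by rw [← hHU]
  refine ⟨U * diagonal (fun i => if 0 ≤ hH.eigenvalues i then 1 else 0) * Uᴴ, ?_, ?_, ?_, ?_⟩
  · refine hdiag _ fun i => ?_
    split_ifs <;> simp
  · rw [hone, hsub]
    refine hdiag _ fun i => ?_
    split_ifs <;> simp
  · rw [hPH, hmul]
    refine hdiag _ fun i => ?_
    split_ifs with h
    · simpa using h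
    · simp
  · have : ∀ Y : Matrix n n ℂ, Y - H =
        Y - U * diagonal (fun i => (hH.eigenvalues i : ℂ)) * Uᴴ := fun Y => by rw [← hHU]
    rw [hPH, this, hmul, hsub]
    refine hdiag _ fun i => ?_
    split_ifs with h
    · simp
    · have : (hH.eigenvalues i : ℂ) ≤ 0 := by exact_mod_cast (not_le.mp h).le
      simpa using this

section Sqrt

open scoped MatrixOrder Matrix.Norms.L2Operator

/-- For `σ ≤ τ` with `τ` invertible, `T = σ^{1/2} τ^{-1/2}` is a contraction with `T τ T† = σ`
and `Re Tr (T τ) = Tr (σ^{1/2} τ^{1/2}) ≥ Tr σ`. -/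
lemma exists_contraction {σ τ : Matrix n n ℂ} (hσ : σ.PosSemidef) (hτ : τ.PosDef)
    (h : (τ - σ).PosSemidef) :
    ∃ T : Matrix n n ℂ, (1 - Tᴴ * T).PosSemidef ∧ T * τ * Tᴴ = σ ∧
      σ.trace.re ≤ (T * τ).trace.re := by
  set S := CFC.sqrt σ
  set R := CFC.sqrt τ
  have hS0 : S.PosSemidef := nonneg_iff_posSemidef.mp (CFC.sqrt_nonneg σ)
  have hR0 : R.PosSemidef := nonneg_iff_posSemidef.mp (CFC.sqrt_nonneg τ)
  have hSS : S * S = σ := CFC.sqrt_mul_sqrt_self σ hσ.nonneg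
  have hRR : R * R = τ := CFC.sqrt_mul_sqrt_self τ hτ.posSemidef.nonneg
  -- Operator monotonicity of the square root; it gives `Tr (S R) ≥ Tr (S S)` below.
  have hRS : (R - S).PosSemidef := le_iff.mp (CFC.monotone_sqrt (le_iff.mpr h))
  have hdet : IsUnit R.det := by
    have h1 : IsUnit τ.det := (Matrix.isUnit_iff_isUnit_det τ).mp hτ.isUnit
    rw [← hRR, det_mul] at h1
    exact isUnit_of_mul_isUnit_left h1
  have hRi : (R⁻¹)ᴴ = R⁻¹ := by rw [conjTranspose_nonsing_inv, hR0.isHermitian.eq]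
  have e1 : R⁻¹ * R = 1 := nonsing_inv_mul _ hdet
  have e2 : R * R⁻¹ = 1 := mul_nonsing_inv _ hdet
  refine ⟨S * R⁻¹, ?_, ?_, ?_⟩
  · have := h.conjTranspose_mul_mul_same R⁻¹
    convert this using 1
    rw [conjTranspose_mul, hRi, hS0.isHermitian.eq, ← hSS, ← hRR, Matrix.mul_sub, Matrix.sub_mul]
    congr 1
    · rw [← Matrix.mul_assoc, e1, Matrix.one_mul, e2]
    · simp only [Matrix.mul_assoc]
  · rw [conjTranspose_mul, hRi, hS0.isHermitian.eq, ← hSS, ← hRR]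
    calc S * R⁻¹ * (R * R) * (R⁻¹ * S) = S * (R⁻¹ * R) * (R * R⁻¹) * S := by
          simp only [Matrix.mul_assoc]
      _ = S * S := by rw [e1, e2, Matrix.mul_one, Matrix.mul_one]
  · have : S * R⁻¹ * τ = S * R := by
      rw [← hRR, Matrix.mul_assoc, ← Matrix.mul_assoc R⁻¹, e1, Matrix.one_mul]
    rw [this, ← hSS]
    exact re_trace_mul_mono hS0 hRS

end Sqrt

/-- From `(1 - T)†(1 - T) ≥ 0` the Hermitian part of `T` is at most `(1 + T†T) / 2 ≤ 1`. -/
lemma re_trace_mul_le_of_contraction {T τ : Matrix n n ℂ} (hT : (1 - Tᴴ * T).PosSemidef)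
    (hτ : τ.PosSemidef) : (T * τ).trace.re ≤ τ.trace.re := by
  have h1 := re_trace_mul_nonneg hT hτ
  have h2 := re_trace_mul_nonneg (posSemidef_conjTranspose_mul_self (1 - T)) hτ
  have h3 : (1 - T)ᴴ * (1 - T) * τ = τ - T * τ - Tᴴ * τ + Tᴴ * T * τ := by
    rw [conjTranspose_sub, conjTranspose_one]; noncomm_ring
  have h4 := re_trace_conjTranspose_mul T hτ.isHermitian
  rw [h3] at h2
  simp only [Matrix.sub_mul, Matrix.one_mul, trace_sub, trace_add, Complex.sub_re,
    Complex.add_re] at h1 h2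
  linarith

omit [Fintype n] in
lemma posSemidef_one_sub_smul {P : Matrix n n ℂ} (hP : P.PosSemidef) (hP1 : (1 - P).PosSemidef)
    {r : ℝ} (hr1 : r ≤ 1) : (1 - (r : ℂ) • P).PosSemidef := by
  have h : (0 : ℂ) ≤ ((1 - r : ℝ) : ℂ) := by exact_mod_cast sub_nonneg.mpr hr1
  convert hP1.add (hP.smul h) using 1
  rw [Complex.ofReal_sub, sub_smul, Complex.ofReal_one, one_smul]
  abel

/-- If every test for `ρ` at level `ε` has `⟨Q, σ⟩ ≥ μ ε`, then `ρ` can be mapped by a contraction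
`T` close to the identity on `ρ` to an operator below `σ / μ`. -/
lemma exists_smoothing {ρ σ : Matrix n n ℂ} (hρ : IsState ρ) (hσ : σ.PosSemidef) {μ ε δ : ℝ}
    (hμ : 0 < μ) (hε : 0 < ε) (hδ : 0 < δ)
    (h : ∀ Q ∈ tests ε ρ, μ * ε ≤ (hsInner Q σ).re) :
    ∃ T : Matrix n n ℂ, (1 - Tᴴ * T).PosSemidef ∧ (σ - (μ : ℂ) • (T * ρ * Tᴴ)).PosSemidef ∧
      1 - ε - δ ≤ (T * ρ).trace.re := by
  have hμ' : (0 : ℂ) ≤ (μ : ℂ) := by exact_mod_cast hμ.le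
  have hH : ((μ : ℂ) • ρ - σ).IsHermitian := (hρ.1.smul hμ').isHermitian.sub hσ.isHermitian
  obtain ⟨P, hP, hP1, hX, hXH⟩ := exists_positivePart hH
  set X := P * ((μ : ℂ) • ρ - σ) with hXdef
  have hXtr : X.trace.re = μ * (P * ρ).trace.re - (P * σ).trace.re := by
    simp [hXdef, Matrix.mul_sub, trace_sub, trace_smul]
  have hXle : X.trace.re ≤ μ * ε := by
    rcases le_or_gt (P * ρ).trace.re ε with hx | hx
    · have := re_trace_mul_nonneg hP hσ
      have := mul_le_mul_of_nonneg_left hx hμ.le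
      linarith
    -- Here `(ε / x) P` is a test at level exactly `ε`, which forces `Tr (P σ) ≥ μ x`, so `Tr X ≤
    -- 0`.
    · set x := (P * ρ).trace.re with hxdef
      have hx0 : 0 < x := hε.trans hx
      have hr0 : (0 : ℂ) ≤ ((ε / x : ℝ) : ℂ) := by exact_mod_cast (div_pos hε hx0).le
      have hQ : (((ε / x : ℝ) : ℂ) • P).PosSemidef := hP.smul hr0
      have hQ1 := posSemidef_one_sub_smul hP hP1 ((div_le_one hx0).mpr hx.le)
      have key := h _ ⟨hQ, hQ1, by
        rw [hsInner_eq_of_isHermitian hQ.isHermitian, Matrix.smul_mul, trace_smul, smul_eq_mul,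
          Complex.re_ofReal_mul, ← hxdef, div_mul_cancel₀ _ hx0.ne']⟩
      rw [hsInner_eq_of_isHermitian hQ.isHermitian, Matrix.smul_mul, trace_smul, smul_eq_mul,
          Complex.re_ofReal_mul, div_mul_eq_mul_div, le_div_iff₀ hx0] at key
      have : μ * x ≤ (P * σ).trace.re := by
        refine le_of_mul_le_mul_left ?_ hε
        linarith
      have : 0 ≤ μ * ε := by positivity
      linarith
  -- The shift `κ` makes `τ` invertible at a trace cost of at most `μ δ`; the `+ 1` covers an empty
  -- index type.
  set κ : ℝ := μ * δ / (Fintype.card n + 1) with hκ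
  have hκ0 : 0 < κ := by positivity
  have hκn : κ * Fintype.card n ≤ μ * δ := by
    rw [hκ, div_mul_eq_mul_div, div_le_iff₀ (by positivity)]
    have : 0 < μ * δ := by positivity
    nlinarith
  have hκ1 : ((κ : ℂ) • (1 : Matrix n n ℂ)).PosDef :=
    PosDef.one.smul (by exact_mod_cast hκ0)
  have hτ : (σ + X + (κ : ℂ) • (1 : Matrix n n ℂ)).PosDef :=
    PosDef.posSemidef_add (hσ.add hX) hκ1
  set τ := σ + X + (κ : ℂ) • (1 : Matrix n n ℂ) with hτdef
  have hτσ : (τ - σ).PosSemidef := by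
    convert hX.add hκ1.posSemidef using 1
    rw [hτdef]; abel
  have hτρ : (τ - (μ : ℂ) • ρ).PosSemidef := by
    convert hXH.add hκ1.posSemidef using 1
    rw [hτdef]; abel
  obtain ⟨T, hT, hTσ, hTtr⟩ := exists_contraction hσ hτ hτσ
  refine ⟨T, hT, ?_, ?_⟩
  · convert hτρ.mul_mul_conjTranspose_same T using 1
    rw [Matrix.mul_sub, Matrix.sub_mul, hTσ, Matrix.mul_smul, Matrix.smul_mul]
  · have h1 := re_trace_mul_le_of_contraction hT hτρ
    have h2 : τ.trace.re = σ.trace.re + X.trace.re + κ * Fintype.card n := by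
      simp [hτdef, trace_add, trace_smul]
    simp only [Matrix.mul_sub, trace_sub, Matrix.mul_smul, trace_smul, hρ.2, Complex.sub_re,
      smul_eq_mul, Complex.re_ofReal_mul, Complex.ofReal_re, mul_one] at h1
    have h3 : μ * (1 - ε - δ) ≤ μ * (T * ρ).trace.re := by linarith
    exact le_of_mul_le_mul_left h3 hμ

/-- A contraction that is close to the identity on `ρ` hardly changes the outcome of a test. -/
lemma re_trace_test_contraction {ρ T Q : Matrix n n ℂ} (hρ : IsState ρ)
    (hT : (1 - Tᴴ * T).PosSemidef) (hQ : Q.PosSemidef) (hQ1 : (1 - Q).PosSemidef) {c δ : ℝ}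
    (hc : 0 < c) (hc1 : c ≤ 1) (hTρ : 1 - c ^ 2 / 2 - δ ≤ (T * ρ).trace.re) :
    (Q * ρ).trace.re - c - δ / c ≤ (Tᴴ * Q * T * ρ).trace.re := by
  set t : ℝ := c / 2 with ht
  set V : Matrix n n ℂ := 1 - T with hV
  set W : Matrix n n ℂ := (t : ℂ) • (1 + T) with hW
  -- Weighted Cauchy–Schwarz: the cross terms `W†QV + V†QW` equal `2t (Q - T†QT)`. Using `1 - Q`
  -- along with `Q` doubles their coefficient, at the price of `2t (1 - T†T)`, which is absorbed at
  -- the end because `c ≤ 1`.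
  have hpos := add_nonneg (re_trace_mul_nonneg (hQ.conjTranspose_mul_mul_same (W - V)) hρ.1)
    (re_trace_mul_nonneg (hQ1.conjTranspose_mul_mul_same (W + V)) hρ.1)
  have hWt : Wᴴ = (t : ℂ) • (1 + Tᴴ) := by simp [hW, conjTranspose_smul]
  have hVt : Vᴴ = 1 - Tᴴ := by simp [hV]
  have e1 : (W - V)ᴴ * Q * (W - V) * ρ + (W + V)ᴴ * (1 - Q) * (W + V) * ρ =
      ((t ^ 2 : ℝ) : ℂ) • (ρ + T * ρ + Tᴴ * ρ + Tᴴ * T * ρ) +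
        (ρ - T * ρ - Tᴴ * ρ + Tᴴ * T * ρ) + ((2 * t : ℝ) : ℂ) • (ρ - Tᴴ * T * ρ) -
        ((4 * t : ℝ) : ℂ) • (Q * ρ - Tᴴ * Q * T * ρ) := by
    have : (W - V)ᴴ * Q * (W - V) * ρ + (W + V)ᴴ * (1 - Q) * (W + V) * ρ =
        Wᴴ * W * ρ + Vᴴ * V * ρ + (Wᴴ * V + Vᴴ * W) * ρ
          - (2 : ℂ) • ((Wᴴ * Q * V + Vᴴ * Q * W) * ρ) := by
      rw [conjTranspose_sub, conjTranspose_add, two_smul]; noncomm_ring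
    rw [this, hWt, hVt, hW, hV]
    simp only [Matrix.smul_mul, Matrix.mul_smul, Matrix.add_mul, Matrix.mul_add,
      Matrix.sub_mul, Matrix.mul_sub, Matrix.one_mul, Matrix.mul_one]
    push_cast
    module
  have htr := re_trace_conjTranspose_mul T hρ.1.isHermitian
  have hs := re_trace_mul_nonneg hT hρ.1
  rw [← Complex.add_re, ← trace_add, e1] at hpos
  simp only [Matrix.sub_mul, Matrix.one_mul, trace_sub, trace_add, trace_smul, Complex.sub_re,
    Complex.add_re, smul_eq_mul, Complex.re_ofReal_mul, hρ.2, Complex.one_re, htr] at hpos hs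
  set p := (Tᴴ * T * ρ).trace.re
  set f := (T * ρ).trace.re
  have hN := re_trace_mul_nonneg (posSemidef_conjTranspose_mul_self (1 - T)) hρ.1
  have e2 : (1 - T)ᴴ * (1 - T) * ρ = ρ - T * ρ - Tᴴ * ρ + Tᴴ * T * ρ := by
    rw [conjTranspose_sub, conjTranspose_one]; noncomm_ring
  rw [e2] at hN
  simp only [trace_sub, trace_add, Complex.sub_re, Complex.add_re, hρ.2, Complex.one_re,
    htr] at hN
  have hf : f ≤ (1 + p) / 2 := by linarith
  set D := (Q * ρ).trace.re - (Tᴴ * Q * T * ρ).trace.re with hD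
  have hmain : c * (2 * D) ≤ 2 * c * (c + δ / c) := by
    have : 2 * c * (c + δ / c) = 2 * c ^ 2 + 2 * δ := by field_simp
    rw [this]
    have h1 : t ^ 2 * (1 + f + f + p) ≤ t ^ 2 * (2 + 2 * p) :=
      mul_le_mul_of_nonneg_left (by linarith) (sq_nonneg t)
    have h2 : 4 * t * D ≤ t ^ 2 * (2 + 2 * p) + (c ^ 2 + 2 * δ - (1 - p)) + 2 * t * (1 - p) := by
      linarith
    rw [ht] at h2
    nlinarith [mul_nonneg hs (sub_nonneg.mpr hc1), mul_nonneg hs (sq_nonneg c)]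
  have : D ≤ c + δ / c := by nlinarith
  linarith

end Operators

/-! ### Partial trace and tensoring with the identity. -/

section PartialTrace

variable {a d : Type*} [Fintype a]

lemma partialTraceLeft_eq_sum (ρ : Matrix (a × d) (a × d) ℂ) :
    partialTraceLeft ρ = ∑ i, ρ.submatrix (Prod.mk i) (Prod.mk i) := by
  ext j k
  simp [partialTraceLeft, Matrix.sum_apply]

lemma posSemidef_partialTraceLeft {ρ : Matrix (a × d) (a × d) ℂ} (hρ : ρ.PosSemidef) :
    (partialTraceLeft ρ).PosSemidef := by
  rw [partialTraceLeft_eq_sum]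
  exact posSemidef_sum _ fun i _ => hρ.submatrix _

lemma trace_partialTraceLeft [Fintype d] (ρ : Matrix (a × d) (a × d) ℂ) :
    (partialTraceLeft ρ).trace = ρ.trace := by
  simp [partialTraceLeft, Matrix.trace, Fintype.sum_prod_type_right]

lemma isState_partialTraceLeft [Fintype d] {ρ : Matrix (a × d) (a × d) ℂ} (hρ : IsState ρ) :
    IsState (partialTraceLeft ρ) :=
  ⟨posSemidef_partialTraceLeft hρ.1, (trace_partialTraceLeft ρ).trans hρ.2⟩

lemma posSemidef_one_kronecker {m : Type*} [Fintype m] [DecidableEq m] [Fintype d]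
    {σ : Matrix d d ℂ} (hσ : σ.PosSemidef) : ((1 : Matrix m m ℂ) ⊗ₖ σ).PosSemidef :=
  PosSemidef.one.kronecker hσ

lemma trace_one_kronecker_mul [DecidableEq a] [Fintype d] (M : Matrix d d ℂ)
    (ρ : Matrix (a × d) (a × d) ℂ) :
    (((1 : Matrix a a ℂ) ⊗ₖ M) * ρ).trace = (M * partialTraceLeft ρ).trace := by
  have h : ∀ i j, (((1 : Matrix a a ℂ) ⊗ₖ M) * ρ) (i, j) (i, j) =
      ∑ k, M j k * ρ (i, k) (i, j) := fun i j => by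
    rw [Matrix.mul_apply, Fintype.sum_prod_type, Finset.sum_eq_single i]
    · simp [kroneckerMap_apply]
    · intro i' _ hi'
      simp [kroneckerMap_apply, Matrix.one_apply_ne hi'.symm]
    · simp
  simp only [Matrix.trace, Matrix.diag_apply, Fintype.sum_prod_type_right, h]
  refine Finset.sum_congr rfl fun j _ => ?_
  rw [Matrix.mul_apply, Finset.sum_comm]
  simp [partialTraceLeft, Finset.mul_sum]

lemma one_kronecker_sub {m : Type*} [DecidableEq m] (A B : Matrix d d ℂ) :
    (1 : Matrix m m ℂ) ⊗ₖ (A - B) = (1 : Matrix m m ℂ) ⊗ₖ A - (1 : Matrix m m ℂ) ⊗ₖ B := by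
  ext ⟨i, j⟩ ⟨i', j'⟩
  simp [kroneckerMap_apply, mul_sub]

end PartialTrace

/-! ### The chain rule for a single test. -/

section ChainRule

variable {n : Type*} [Fintype n] [DecidableEq n]

lemma le_one_of_mem_tests {ρ Q : Matrix n n ℂ} (hρ : IsState ρ) {η : ℝ} (hQ : Q ∈ tests η ρ) :
    η ≤ 1 := by
  obtain ⟨h0, h1, h⟩ := hQ
  have := re_trace_mul_nonneg h1 hρ.1
  rw [hsInner_eq_of_isHermitian h0.isHermitian] at h
  simp only [Matrix.sub_mul, Matrix.one_mul, trace_sub, hρ.2, Complex.sub_re,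
    Complex.one_re] at this
  linarith

lemma one_mem_tests {ρ : Matrix n n ℂ} (hρ : IsState ρ) {ε : ℝ} (hε : ε ≤ 1) :
    (1 : Matrix n n ℂ) ∈ tests ε ρ := by
  refine ⟨PosSemidef.one, by simpa using PosSemidef.zero, ?_⟩
  simpa [hsInner, hρ.2] using hε

variable {a d : Type*} [Fintype a] [DecidableEq a] [Fintype d] [DecidableEq d]

theorem chain_rule_of_test {ρ : Matrix (a × d) (a × d) ℂ} (hρ : IsState ρ) {σ : Matrix d d ℂ}
    (hσ : σ.PosSemidef) {ε ε' c v w : ℝ} (hε : 0 < ε) (hε' : 0 < ε') (hc : 0 < c)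
    (hc2 : c ^ 2 = 2 * ε') (hv : 0 ≤ v) (hw : 0 ≤ w)
    (h1 : ∀ Q ∈ tests ε ρ, v * ε ≤ (hsInner Q ((1 : Matrix a a ℂ) ⊗ₖ partialTraceLeft ρ)).re)
    (h2 : ∀ Q ∈ tests ε' (partialTraceLeft ρ), w * ε' ≤ (hsInner Q σ).re)
    {Q : Matrix (a × d) (a × d) ℂ} (hQ : Q ∈ tests (ε + 2 * c) ρ) :
    v * w * (ε / (ε + c)) ≤ 1 / (ε + 2 * c) * (hsInner Q ((1 : Matrix a a ℂ) ⊗ₖ σ)).re := by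
  have hη := le_one_of_mem_tests hρ hQ
  obtain ⟨hQ0, hQ1, hQρ⟩ := hQ
  have hIσ := posSemidef_one_kronecker (m := a) hσ
  rw [hsInner_eq_of_isHermitian hQ0.isHermitian] at hQρ ⊢
  rcases hw.eq_or_lt with rfl | hw0
  · have := re_trace_mul_nonneg hQ0 hIσ
    simp only [mul_zero, zero_mul]
    positivity
  -- The slack `δ = c ^ 3` costs only `δ / c = c ^ 2` in success probability.
  obtain ⟨T, hT, hTσ, hTρ⟩ := exists_smoothing (isState_partialTraceLeft hρ) hσ hw0 hε'
    (pow_pos hc 3) h2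
  set T' : Matrix (a × d) (a × d) ℂ := (1 : Matrix a a ℂ) ⊗ₖ T with hT'
  have hT'H : T'ᴴ = (1 : Matrix a a ℂ) ⊗ₖ Tᴴ := by
    rw [hT', conjTranspose_kronecker, conjTranspose_one]
  have hT'1 : (1 - T'ᴴ * T').PosSemidef := by
    have := posSemidef_one_kronecker (m := a) hT
    rwa [one_kronecker_sub, one_kronecker_one, ← Matrix.mul_one (1 : Matrix a a ℂ),
      mul_kronecker_mul, ← hT'H, ← hT'] at this
  rw [← trace_one_kronecker_mul] at hTρ
  have hclose := re_trace_test_contraction hρ hT'1 hQ0 hQ1 hc (by linarith) (δ := c ^ 3)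
    (by rw [hc2]; linarith)
  have hδ : c ^ 3 / c = c ^ 2 := by field_simp
  rw [hδ] at hclose
  set Q' := T'ᴴ * Q * T' with hQ'
  have hQ'0 : Q'.PosSemidef := hQ0.conjTranspose_mul_mul_same T'
  have hQ'1 : (1 - Q').PosSemidef := by
    convert hT'1.add (hQ1.conjTranspose_mul_mul_same T') using 1
    rw [hQ']; noncomm_ring
  set e : ℝ := ε + c - c ^ 2 with he
  have hεe : ε ≤ e := by nlinarith
  have he0 : 0 < e := hε.trans_le hεe
  have hr0 : (0 : ℂ) ≤ ((ε / e : ℝ) : ℂ) := by exact_mod_cast (div_pos hε he0).le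
  have hQs := hQ'0.smul hr0
  have key := h1 (((ε / e : ℝ) : ℂ) • Q') ⟨hQs,
    posSemidef_one_sub_smul hQ'0 hQ'1 ((div_le_one he0).mpr hεe), by
      rw [hsInner_eq_of_isHermitian hQs.isHermitian, Matrix.smul_mul, trace_smul, smul_eq_mul,
        Complex.re_ofReal_mul, div_mul_eq_mul_div, le_div_iff₀ he0]
      exact mul_le_mul_of_nonneg_left (by linarith) hε.le⟩
  rw [hsInner_eq_of_isHermitian hQs.isHermitian, Matrix.smul_mul, trace_smul, smul_eq_mul,
    Complex.re_ofReal_mul, div_mul_eq_mul_div, le_div_iff₀ he0] at key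
  have key1 : v * e ≤ (Q' * ((1 : Matrix a a ℂ) ⊗ₖ partialTraceLeft ρ)).trace.re :=
    le_of_mul_le_mul_left (by linarith) hε
  have key2 : w * (Q' * ((1 : Matrix a a ℂ) ⊗ₖ partialTraceLeft ρ)).trace.re ≤
      (Q * ((1 : Matrix a a ℂ) ⊗ₖ σ)).trace.re := by
    have := re_trace_mul_nonneg hQ0 (posSemidef_one_kronecker (m := a) hTσ)
    have e1 : (Q' * ((1 : Matrix a a ℂ) ⊗ₖ partialTraceLeft ρ)).trace =
        (Q * ((1 : Matrix a a ℂ) ⊗ₖ (T * partialTraceLeft ρ * Tᴴ))).trace := by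
      rw [hQ', Matrix.mul_assoc, Matrix.mul_assoc, trace_mul_comm, hT'H, hT']
      simp only [Matrix.mul_assoc, ← mul_kronecker_mul, Matrix.one_mul]
    rw [one_kronecker_sub, Matrix.mul_sub, trace_sub, kronecker_smul, Matrix.mul_smul, trace_smul,
      ← e1, Complex.sub_re, smul_eq_mul, Complex.re_ofReal_mul] at this
    linarith
  have key3 : v * w * e ≤ (Q * ((1 : Matrix a a ℂ) ⊗ₖ σ)).trace.re := by
    have := mul_le_mul_of_nonneg_left key1 hw
    linarith
  -- The difference of the two sides is `c ^ 2 * (1 - (ε + c))`.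
  have harith : ε * (ε + 2 * c) ≤ e * (ε + c) := by
    have : 0 ≤ c ^ 2 * (1 - (ε + c)) := mul_nonneg (sq_nonneg c) (by linarith)
    rw [he]; linarith
  rw [one_div_mul_eq_div, mul_div_assoc', div_le_div_iff₀ (by linarith) (by linarith)]
  have h5 := mul_le_mul_of_nonneg_left harith (mul_nonneg hv hw)
  have h6 := mul_le_mul_of_nonneg_right key3 (show 0 ≤ ε + c by linarith)
  linarith

end ChainRule

/-! ### Extended logarithms, optimal values and regrouping of tensor factors. -/

section Entropy

lemma log2_mono {x y : ℝ≥0∞} (h : x ≤ y) : log2 x ≤ log2 y :=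
  EReal.div_le_div_right_of_nonneg (by exact_mod_cast (Real.log_pos one_lt_two).le)
    (ENNReal.log_monotone h)

/-- No side condition is needed: `0 * ⊤ = 0` matches `⊥ + ⊤ = ⊥`. -/
lemma log2_mul (x y : ℝ≥0∞) : log2 (x * y) = log2 x + log2 y := by
  rw [log2, log2, log2, ENNReal.log_mul_add, EReal.div_eq_inv_mul, EReal.div_eq_inv_mul,
    EReal.div_eq_inv_mul, ← EReal.coe_inv]
  exact EReal.left_distrib_of_nonneg_of_ne_top (by exact_mod_cast
    (inv_pos.mpr (Real.log_pos one_lt_two)).le) (EReal.coe_ne_top _) _ _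

lemma log2_ofReal {x : ℝ} (hx : 0 < x) : log2 (ENNReal.ofReal x) = (Real.logb 2 x : ℝ) := by
  rw [log2, ENNReal.log_ofReal_of_pos hx, ← EReal.coe_div, Real.logb]

variable {n : Type*} [Fintype n] [DecidableEq n]

lemma condEntropyH_eq {a d : Type*} [Fintype a] [DecidableEq a] [Fintype d] [DecidableEq d]
    (ε : ℝ) (ρ : Matrix (a × d) (a × d) ℂ) :
    condEntropyH ε ρ = log2 (optValue ε ρ ((1 : Matrix a a ℂ) ⊗ₖ partialTraceLeft ρ)) := by
  rw [condEntropyH, relEntropyH, neg_neg]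

lemma optValue_ne_top {ρ : Matrix n n ℂ} (hρ : IsState ρ) (σ : Matrix n n ℂ) {ε : ℝ}
    (hε : ε ≤ 1) : optValue ε ρ σ ≠ ⊤ :=
  ((iInf₂_le _ (one_mem_tests hρ hε)).trans_lt ENNReal.ofReal_lt_top).ne

lemma optValue_toReal_mul_le {ρ σ : Matrix n n ℂ} (hσ : σ.PosSemidef) {ε : ℝ} (hε : 0 < ε)
    {Q : Matrix n n ℂ} (hQ : Q ∈ tests ε ρ) :
    (optValue ε ρ σ).toReal * ε ≤ (hsInner Q σ).re := by
  have h0 : 0 ≤ (hsInner Q σ).re := by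
    rw [hsInner_eq_of_isHermitian hQ.1.isHermitian]
    exact re_trace_mul_nonneg hQ.1 hσ
  have h : (optValue ε ρ σ).toReal ≤ 1 / ε * (hsInner Q σ).re :=
    ENNReal.toReal_le_of_le_ofReal (by positivity) (iInf₂_le Q hQ)
  rwa [one_div_mul_eq_div, le_div_iff₀ hε] at h

lemma partialTraceLeft_regroup {a b c : Type*} [Fintype a] [Fintype b]
    (ρ : Matrix (a × b × c) (a × b × c) ℂ) :
    partialTraceLeft (regroup ρ) = partialTraceLeft (partialTraceLeft ρ) := by
  ext j k
  simp [partialTraceLeft, regroup, Fintype.sum_prod_type_right]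

lemma hsInner_reindex {m n : Type*} [Fintype m] [Fintype n] (f : m ≃ n) (Q : Matrix m m ℂ)
    (σ : Matrix n n ℂ) :
    hsInner Q (σ.submatrix f f) = hsInner (Q.submatrix f.symm f.symm) σ := by
  rw [hsInner, hsInner, conjTranspose_submatrix]
  have : (Qᴴ * σ.submatrix f f) =
      (Qᴴ.submatrix f.symm f.symm * σ).submatrix f f := by
    rw [← submatrix_mul_equiv _ _ _ f]
    simp
  rw [this]
  exact f.sum_comp fun i => (Qᴴ.submatrix f.symm f.symm * σ) i i

lemma submatrix_symm_mem_tests {m : Type*} [Fintype m] [DecidableEq m] (f : m ≃ n) {ε : ℝ}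
    {Q : Matrix m m ℂ} {ρ : Matrix n n ℂ} (hQ : Q ∈ tests ε (ρ.submatrix f f)) :
    Q.submatrix f.symm f.symm ∈ tests ε ρ := by
  refine ⟨hQ.1.submatrix _, ?_, ?_⟩
  · have := hQ.2.1.submatrix f.symm
    rwa [show (1 - Q).submatrix f.symm f.symm = 1 - Q.submatrix f.symm f.symm by
      rw [← submatrix_one_equiv f.symm]; rfl] at this
  · rw [← hsInner_reindex]; exact hQ.2.2

lemma one_kronecker_regroup {a b c : Type*} [DecidableEq a] [DecidableEq b]
    (σ : Matrix c c ℂ) :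
    (1 : Matrix (a × b) (a × b) ℂ) ⊗ₖ σ =
      ((1 : Matrix a a ℂ) ⊗ₖ ((1 : Matrix b b ℂ) ⊗ₖ σ)).submatrix
        (Equiv.prodAssoc a b c) (Equiv.prodAssoc a b c) := by
  rw [← one_kronecker_one (m := a) (n := b)]
  ext ⟨⟨i, j⟩, k⟩ ⟨⟨i', j'⟩, k'⟩
  exact mul_assoc _ _ _

end Entropy

end HypothesisEntropy

open HypothesisEntropy in
theorem mainTheorem4 {a b c : Type*} [Fintype a] [DecidableEq a] [Fintype b] [DecidableEq b]
    [Fintype c] [DecidableEq c] (ρ : Matrix (a × b × c) (a × b × c) ℂ)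
    (hρ : HypothesisEntropy.IsState ρ) (ε ε' : ℝ) (hε : 0 < ε) (hε' : 0 < ε') :
    HypothesisEntropy.condEntropyH (ε + Real.sqrt (8 * ε')) (HypothesisEntropy.regroup ρ) ≥
      HypothesisEntropy.condEntropyH ε ρ
        + HypothesisEntropy.condEntropyH ε' (HypothesisEntropy.partialTraceLeft ρ)
        - ((Real.logb 2 ((ε + Real.sqrt (2 * ε')) / ε) : ℝ) : EReal) := by
  set r := Real.sqrt (2 * ε')
  have hr0 : 0 < r := Real.sqrt_pos.mpr (by positivity)
  have hr2 : r ^ 2 = 2 * ε' := Real.sq_sqrt (by positivity)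
  have hr8 : Real.sqrt (8 * ε') = 2 * r := by
    rw [Real.sqrt_eq_iff_mul_self_eq (by positivity) (by positivity)]
    linarith
  have hlog : ((Real.logb 2 ((ε + r) / ε) : ℝ) : EReal) =
      -log2 (ENNReal.ofReal (ε / (ε + r))) := by
    rw [log2_ofReal (by positivity), ← EReal.coe_neg, ← Real.logb_inv, inv_div]
  rw [ge_iff_le, hlog, sub_eq_add_neg, neg_neg, hr8, condEntropyH_eq, condEntropyH_eq, condEntropyH_eq,
    ← log2_mul, ← log2_mul]
  refine log2_mono (le_iInf₂ fun Q hQ => ?_)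
  have hBC := isState_partialTraceLeft hρ
  have hC := isState_partialTraceLeft hBC
  rw [partialTraceLeft_regroup, one_kronecker_regroup, hsInner_reindex]
  have hQ' := submatrix_symm_mem_tests (Equiv.prodAssoc a b c) hQ
  -- The existence of a test gives `ε + 2r ≤ 1`, hence finite optimal values at levels `ε` and `ε'`.
  -- Without tests the infimum on the left is `⊤`.
  have hη := le_one_of_mem_tests hρ hQ'
  have hε1 : ε ≤ 1 := by linarith
  have hε'1 : ε' ≤ 1 := by nlinarith
  have hσ := posSemidef_one_kronecker (m := b) hC.1
  rw [← ENNReal.ofReal_toReal (optValue_ne_top hρ _ hε1),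
    ← ENNReal.ofReal_toReal (optValue_ne_top hBC _ hε'1),
    ← ENNReal.ofReal_mul ENNReal.toReal_nonneg, ← ENNReal.ofReal_mul (by positivity)]
  refine ENNReal.ofReal_le_ofReal ?_
  exact chain_rule_of_test hρ hσ hε hε' hr0 hr2 ENNReal.toReal_nonneg ENNReal.toReal_nonneg
    (fun _ h => optValue_toReal_mul_le (posSemidef_one_kronecker hBC.1) hε h)
    (fun _ h => optValue_toReal_mul_le hσ hε' h) hQ'
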